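/- Let $X$ be the wedge at $0$ of copies $\mathbb{R}_s$ of $\mathbb{R}$ indexed by all infinite sequences $s=(s_1,s_2,\dots)$ of positive integers, that is, the quotient of the diffeological coproduct $\coprod_s \mathbb{R}_s$ obtained by identifying all the origins, with the quotient diffeology. Let $V=F(X)$ be the vector space $\bigoplus_{x\in X}\mathbb{R}$ with basis $\{[x] : x\in X\}$, equipped with the diffeology generated by the maps $$(\mathbb{R}\times X)^n\to V,\qquad (r_1,x_1,\dots,r_n,x_n)\mapsto \sum_{i=1}^n r_i[x_i]\qquad (n\ge 1).$$ For a diffeological space $Y$ write $D(Y)$ for $Y$ with its $D$-topology, the finest topology for which all plots are continuous. Then: 1. $V$ is the free diffeological vector space generated by $X$: $V$ is a diffeological vector space (addition and scalar multiplication are smooth), $x\mapsto [x]$ is smooth, and every smooth map $f:X\to W$ to a diffeological vector space $W$ has the form $f(x)=g([x])$ for a unique smooth linear map $g:V\to W$. 2. $V$ is projective: for every linear subduction $\pi:W_1\to W_2$ of diffeological vector spaces and every smooth linear map $g:V\to W_2$ there is a smooth linear map $h:V\to W_1$ with $\pi\circ h=g$. 3. $D(V)$ is not a topological vector space. More precisely,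 the addition $D(V)\times D(V)\to D(V)$ is not continuous for the product topology on $D(V)\times D(V)$; that is, there is a closed subset of $D(V)$ whose preimage under addition is not closed in $D(V)\times D(V)$. -/

import Mathlib

open Diffeology Topology

universe u v w

noncomputable section

namespace DVS

/-! ### Constructions on diffeological spaces -/

/-- The product diffeology: the plots are the maps both components of which are plots. -/
instance instProd {X Y : Type*} [DiffeologicalSpace X] [DiffeologicalSpace Y] :
    DiffeologicalSpace (X × Y) where
  plots n := {p | IsPlot (fun a => (p a).1) ∧ IsPlot (fun a => (p a).2)}
  constant_plots x := ⟨isPlot_const, isPlot_const⟩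
  plot_reparam hp hf := ⟨isPlot_reparam hp.1 hf, isPlot_reparam hp.2 hf⟩
  locality {n p} hp := by
    constructor
    · refine DiffeologicalSpace.locality fun x => ?_
      obtain ⟨a, ha, hx, h⟩ := hp x
      exact ⟨a, ha, hx, fun hfa hf => (h hfa hf).1⟩
    · refine DiffeologicalSpace.locality fun x => ?_
      obtain ⟨a, ha, hx, h⟩ := hp x
      exact ⟨a, ha, hx, fun hfa hf => (h hfa hf).2⟩

/-- The product diffeology on a power: the plots are the maps all components of which are plots. -/
instance instPow {ι X : Type*} [DiffeologicalSpace X] : DiffeologicalSpace (ι → X) where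
  plots n := {p | ∀ i, IsPlot (fun a => p a i)}
  constant_plots x _ := isPlot_const
  plot_reparam hp hf i := isPlot_reparam (hp i) hf
  locality {n p} hp i := by
    refine DiffeologicalSpace.locality fun x => ?_
    obtain ⟨a, ha, hx, h⟩ := hp x
    exact ⟨a, ha, hx, fun hfa hf => h hfa hf i⟩

/-- The diffeology pushed forward along `f`: the smallest diffeology on `Y` for which `f` is smooth.
For the projection to a quotient it is the quotient diffeology. -/
abbrev coinduced {X Y : Type*} [DiffeologicalSpace X] (f : X → Y) : DiffeologicalSpace Y :=
  DiffeologicalSpace.generateFrom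
    {q | ∃ p : EuclideanSpace ℝ (Fin q.1) → X, IsPlot p ∧ q.2 = f ∘ p}

/-- The coproduct (disjoint union) diffeology: the smallest diffeology for which all the inclusions
of the summands are smooth. -/
instance instSigma {ι : Type*} {X : ι → Type*} [∀ i, DiffeologicalSpace (X i)] :
    DiffeologicalSpace (Σ i, X i) :=
  DiffeologicalSpace.generateFrom
    {q | ∃ (i : ι) (p : EuclideanSpace ℝ (Fin q.1) → X i), IsPlot p ∧ q.2 = Sigma.mk i ∘ p}

/-- A subduction: a surjection onto a space that carries the quotient diffeology. -/
def IsSubduction {X Y : Type*} [DiffeologicalSpace X] [dY : DiffeologicalSpace Y]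
    (f : X → Y) : Prop :=
  Function.Surjective f ∧ dY = coinduced f

/-- The relation on a disjoint union of copies of `ℝ` that identifies all the origins. -/
def wedgeSetoid (ι : Type*) : Setoid (Σ _ : ι, ℝ) where
  r a b := a = b ∨ (a.2 = 0 ∧ b.2 = 0)
  iseqv :=
    { refl := fun _ => Or.inl rfl
      symm := by
        rintro a b (h | h)
        · exact Or.inl h.symm
        · exact Or.inr ⟨h.2, h.1⟩
      trans := by
        rintro a b c (rfl | h) (rfl | h')
        · exact Or.inl rfl
        · exact Or.inr h'
        · exact Or.inr h
        · exact Or.inr ⟨h.1, h'.2⟩ }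

/-- The wedge at `0` of copies of `ℝ` indexed by a (nonempty) type `ι`. -/
def Wedge (ι : Type*) : Type _ := Quotient (wedgeSetoid ι)

/-- The point `x` of the copy of `ℝ` with index `i`. -/
def Wedge.mk {ι : Type*} (a : Σ _ : ι, ℝ) : Wedge ι := Quotient.mk (wedgeSetoid ι) a

/-- The wedge carries the quotient diffeology of the disjoint union. -/
instance instWedge {ι : Type*} : DiffeologicalSpace (Wedge ι) := coinduced Wedge.mk

/-! ### Diffeological vector spaces -/

/-- Diffeological vector spaces: addition and scalar multiplication are smooth. -/
structure IsDiffeologicalVectorSpace (V : Type*) [AddCommGroup V] [Module ℝ V]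
    [DiffeologicalSpace V] : Prop where
  dSmooth_add : DSmooth fun z : V × V => z.1 + z.2
  dSmooth_smul : DSmooth fun z : ℝ × V => z.1 • z.2

/-- `D(V)` is a topological vector space: addition and scalar multiplication are continuous
for the D-topology on `V`, and the product topologies on `V × V` and `ℝ × V`. -/
def IsTopologicalVectorSpaceD (V : Type*) [AddCommGroup V] [Module ℝ V]
    [DiffeologicalSpace V] : Prop :=
  letI : TopologicalSpace V := dTopology
  Continuous (fun z : V × V => z.1 + z.2) ∧ Continuous (fun z : ℝ × V => z.1 • z.2)

/-- Projective diffeological vector spaces: smooth linear maps lift along linear subductions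
of diffeological vector spaces. -/
def IsProjective (P : Type w) [AddCommGroup P] [Module ℝ P] [DiffeologicalSpace P] : Prop :=
  IsDiffeologicalVectorSpace P ∧
    ∀ (V : Type u) (W : Type v) [AddCommGroup V] [Module ℝ V] [DiffeologicalSpace V]
      [AddCommGroup W] [Module ℝ W] [DiffeologicalSpace W],
      IsDiffeologicalVectorSpace V → IsDiffeologicalVectorSpace W →
      ∀ π : V →ₗ[ℝ] W, IsSubduction π →
      ∀ g : P →ₗ[ℝ] W, DSmooth g → ∃ h : P →ₗ[ℝ] V, DSmooth h ∧ π ∘ₗ h = g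

/-- The vector space `⨁_{x ∈ X} ℝ` with basis `X`, which underlies the free diffeological
vector space `F(X)`. -/
abbrev FreeDVS (X : Type*) : Type _ := X →₀ ℝ

/-- The map `(ℝ × X)ⁿ → F(X)`, `(r₁, x₁, …, rₙ, xₙ) ↦ r₁ [x₁] + ⋯ + rₙ [xₙ]`. -/
def rho (X : Type*) (n : ℕ) (z : Fin n → ℝ × X) : FreeDVS X :=
  ∑ i, Finsupp.single (z i).2 (z i).1

/-- The diffeology of `F(X)`: it is generated by the maps `rho X n`, `n > 0`, that is, it is the
smallest diffeology for which all of them are smooth. -/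
instance instFreeDVS {X : Type*} [DiffeologicalSpace X] : DiffeologicalSpace (X →₀ ℝ) :=
  DiffeologicalSpace.generateFrom
    {q | ∃ n : ℕ, 0 < n ∧ ∃ p : EuclideanSpace ℝ (Fin q.1) → (Fin n → ℝ × X),
      IsPlot p ∧ q.2 = rho X n ∘ p}

/-- The canonical map `X → F(X)`, `x ↦ [x]`. -/
def FreeDVS.of {X : Type*} (x : X) : FreeDVS X := Finsupp.single x 1

/-- `F`, together with `i : X → F`, is a free diffeological vector space generated by `X`:
every smooth map from `X` to a diffeological vector space factors through `i` by a unique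
smooth linear map. -/
def IsFreeOn {X : Type v} [DiffeologicalSpace X] {F : Type w} [AddCommGroup F] [Module ℝ F]
    [DiffeologicalSpace F] (i : X → F) : Prop :=
  IsDiffeologicalVectorSpace F ∧ DSmooth i ∧
    ∀ (V : Type u) [AddCommGroup V] [Module ℝ V] [DiffeologicalSpace V],
      IsDiffeologicalVectorSpace V → ∀ f : X → V, DSmooth f →
        ∃! g : F →ₗ[ℝ] V, DSmooth g ∧ ∀ x, g (i x) = f x

/-- The wedge at `0` of copies of `ℝ` indexed by all infinite sequences of positive integers. -/
abbrev SeqWedge : Type := Wedge (ℕ+ → ℕ+)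

end DVS

end

noncomputable section

open scoped ContDiff

namespace DVS

/-! ### Generated diffeologies -/

/-! Freeness: plots of F(X) are locally finite sums of terms r[c] with r, c plots, so the linear
extension of a smooth f sends them to sums of r • f(c), which are plots.

Projectivity: a plot lifts along a linear subduction, since local lifts can be averaged by a smooth
partition of unity. Curves therefore lift, with prescribed value at 0, and lifts over the branches
of a wedge glue.

Failure of continuity: let A be the set of all `pairSum s j`. A plot of F(X) locally meets finitely
many branches, hence finitely many elements of A, so A is closed. Any neighbourhoods U, W of [o],
for o the origin, contain [1/m] on each branch for m large, with a bound depending on the branch. A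
sequence s dominating the bounds for W on the constant branches yields, by a diagonal choice, an
element of A in U + W, although [o] + [o] is not in A (`not_isClosed_preimage_range_pairSum`). -/

/-- A smooth map into a given neighbourhood of `x` that is the identity near `x`. -/
theorem exists_contDiff_eventuallyEq_id {E : Type*} [NormedAddCommGroup E] [InnerProductSpace ℝ E]
    {u : Set E} {x : E} (hu : u ∈ 𝓝 x) :
    ∃ f : E → E, ContDiff ℝ ∞ f ∧ (∀ y, f y ∈ u) ∧ f =ᶠ[𝓝 x] id := by
  obtain ⟨ε, hε, hεu⟩ := Metric.mem_nhds_iff.1 hu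
  let χ : ContDiffBump x := ⟨ε / 2, ε, by positivity, by linarith⟩
  refine ⟨fun y => x + χ y • (y - x), ?_, fun y => hεu ?_, ?_⟩
  · exact contDiff_const.add (χ.contDiff.smul (contDiff_id.sub contDiff_const))
  · dsimp only
    by_cases hy : ε ≤ dist y x
    · rw [χ.zero_of_le_dist hy]
      simpa using hε
    · rw [Metric.mem_ball, dist_eq_norm, add_sub_cancel_left, norm_smul, Real.norm_eq_abs,
        abs_of_nonneg χ.nonneg, ← dist_eq_norm]
      exact (mul_le_of_le_one_left dist_nonneg χ.le_one).trans_lt (not_le.1 hy)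
  · filter_upwards [χ.eventuallyEq_one] with y hy
    simp [hy]

/-- A map that locally agrees with plots is a plot. -/
theorem isPlot_of_eventuallyEq {X : Type*} [DiffeologicalSpace X] {n : ℕ}
    {p : EuclideanSpace ℝ (Fin n) → X}
    (h : ∀ x, ∃ q : EuclideanSpace ℝ (Fin n) → X, IsPlot q ∧ p =ᶠ[𝓝 x] q) : IsPlot p := by
  refine DiffeologicalSpace.locality fun x => ?_
  obtain ⟨q, hq, hpq⟩ := h x
  obtain ⟨u, hu, huo, hxu⟩ := eventually_nhds_iff.1 hpq
  refine ⟨u, huo, hxu, fun {m f} hfu hf => ?_⟩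
  have : p ∘ f = q ∘ f := funext fun y => hu _ (hfu y)
  rw [this]
  exact isPlot_reparam hq hf

/-- If a set of maps contains the constants and is closed under smooth reparametrisation, then the
plots of the diffeology it generates are the maps that locally belong to it. -/
theorem isPlot_generateFrom_iff {X : Type*}
    {g : Set ((n : ℕ) × (EuclideanSpace ℝ (Fin n) → X))}
    (hc : ∀ (n : ℕ) (x : X), ⟨n, fun _ => x⟩ ∈ g)
    (hr : ∀ (n m : ℕ) (p : EuclideanSpace ℝ (Fin m) → X)
      (f : EuclideanSpace ℝ (Fin n) → EuclideanSpace ℝ (Fin m)),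
      ⟨m, p⟩ ∈ g → ContDiff ℝ ∞ f → ⟨n, p ∘ f⟩ ∈ g)
    {n : ℕ} {p : EuclideanSpace ℝ (Fin n) → X} :
    @IsPlot _ (DiffeologicalSpace.generateFrom g) n p ↔
      ∀ x, ∃ q : EuclideanSpace ℝ (Fin n) → X, ⟨n, q⟩ ∈ g ∧ p =ᶠ[𝓝 x] q := by
  constructor
  · intro hp
    -- The maps locally in `g` form a diffeology containing `g`, and a plot of the generated
    -- diffeology is a plot of every such diffeology.
    let d : DiffeologicalSpace X :=
      { plots := fun n => {p | ∀ x, ∃ q : EuclideanSpace ℝ (Fin n) → X,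
          ⟨n, q⟩ ∈ g ∧ p =ᶠ[𝓝 x] q}
        constant_plots := fun x _ => ⟨_, hc _ x, Filter.EventuallyEq.rfl⟩
        plot_reparam := by
          intro n m p f hp hf x
          obtain ⟨q, hq, hpq⟩ := hp (f x)
          exact ⟨q ∘ f, hr _ _ _ _ hq hf, hf.continuous.continuousAt.eventually hpq⟩
        locality := by
          intro n p hp x
          obtain ⟨u, huo, hxu, h⟩ := hp x
          obtain ⟨f, hf, hfu, hfx⟩ := exists_contDiff_eventuallyEq_id (huo.mem_nhds hxu)
          obtain ⟨q, hq, hpq⟩ := h hfu hf x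
          refine ⟨q, hq, ?_⟩
          filter_upwards [hpq, hfx] with y hy hfy
          simpa [hfy] using hy }
    exact hp d fun q hq _ => ⟨q.2, hq, Filter.EventuallyEq.rfl⟩
  · intro h
    refine @isPlot_of_eventuallyEq X (DiffeologicalSpace.generateFrom g) n p fun x => ?_
    obtain ⟨q, hq, hpq⟩ := h x
    exact ⟨q, DiffeologicalSpace.isPlot_generatedFrom_of_mem hq, hpq⟩

theorem isPlot_coinduced_iff {X Y : Type*} [DiffeologicalSpace X] {f : X → Y}
    (hf : Function.Surjective f) {n : ℕ} {p : EuclideanSpace ℝ (Fin n) → Y} :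
    @IsPlot _ (coinduced f) n p ↔
      ∀ x, ∃ q : EuclideanSpace ℝ (Fin n) → X, IsPlot q ∧ p =ᶠ[𝓝 x] f ∘ q := by
  refine (isPlot_generateFrom_iff ?_ ?_).trans (forall_congr' fun x => ?_)
  · intro n y
    obtain ⟨x, rfl⟩ := hf y
    exact ⟨fun _ => x, isPlot_const, rfl⟩
  · rintro n m p h ⟨q, hq, hp⟩ hh
    exact ⟨q ∘ h, isPlot_reparam hq hh, congrArg (· ∘ h) hp⟩
  · constructor
    · rintro ⟨p, ⟨q, hq, hp⟩, h⟩
      exact ⟨q, hq, h.trans (.of_eq hp)⟩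
    · rintro ⟨q, hq, h⟩
      exact ⟨_, ⟨q, hq, rfl⟩, h⟩

theorem isPlot_sigma_iff {ι : Type*} {X : ι → Type*} [∀ i, DiffeologicalSpace (X i)] {n : ℕ}
    {p : EuclideanSpace ℝ (Fin n) → Σ i, X i} :
    IsPlot p ↔ ∀ x, ∃ (i : ι) (q : EuclideanSpace ℝ (Fin n) → X i), IsPlot q ∧
      p =ᶠ[𝓝 x] Sigma.mk i ∘ q := by
  refine (isPlot_generateFrom_iff ?_ ?_).trans (forall_congr' fun x => ?_)
  · rintro n ⟨i, x⟩
    exact ⟨i, fun _ => x, isPlot_const, rfl⟩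
  · rintro n m p h ⟨i, q, hq, hp⟩ hh
    exact ⟨i, q ∘ h, isPlot_reparam hq hh, congrArg (· ∘ h) hp⟩
  · constructor
    · rintro ⟨p, ⟨i, q, hq, hp⟩, h⟩
      exact ⟨i, q, hq, h.trans (.of_eq hp)⟩
    · rintro ⟨i, q, hq, h⟩
      exact ⟨_, ⟨i, q, hq, rfl⟩, h⟩

/-! ### Wedges -/

theorem Wedge.mk_surjective {ι : Type*} : Function.Surjective (Wedge.mk (ι := ι)) :=
  Quotient.mk_surjective

theorem Wedge.mk_eq_mk {ι : Type*} {a b : Σ _ : ι, ℝ} :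
    Wedge.mk a = Wedge.mk b ↔ a = b ∨ (a.2 = 0 ∧ b.2 = 0) :=
  Quotient.eq (r := wedgeSetoid ι)

theorem isPlot_wedge_iff {ι : Type*} {n : ℕ} {p : EuclideanSpace ℝ (Fin n) → Wedge ι} :
    IsPlot p ↔ ∀ x, ∃ (i : ι) (t : EuclideanSpace ℝ (Fin n) → ℝ), IsPlot t ∧
      p =ᶠ[𝓝 x] fun y => Wedge.mk ⟨i, t y⟩ := by
  refine (isPlot_coinduced_iff Wedge.mk_surjective).trans (forall_congr' fun x => ?_)
  constructor
  · rintro ⟨q, hq, h⟩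
    obtain ⟨i, t, ht, h'⟩ := isPlot_sigma_iff.1 hq x
    refine ⟨i, t, ht, h.trans ?_⟩
    filter_upwards [h'] with y hy
    simp [hy]
  · rintro ⟨i, t, ht, h⟩
    exact ⟨fun y => ⟨i, t y⟩, isPlot_sigma_iff.2 fun _ => ⟨i, t, ht, Filter.EventuallyEq.rfl⟩, h⟩

theorem dSmooth_wedge_iff {ι Y : Type*} [DiffeologicalSpace Y] {f : Wedge ι → Y} :
    DSmooth f ↔ ∀ i, DSmooth fun t : ℝ => f (Wedge.mk ⟨i, t⟩) := by
  constructor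
  · intro hf i n t ht
    exact hf n (fun y => Wedge.mk ⟨i, t y⟩)
      (isPlot_wedge_iff.2 fun _ => ⟨i, t, ht, Filter.EventuallyEq.rfl⟩)
  · intro hf n p hp
    refine isPlot_of_eventuallyEq fun x => ?_
    obtain ⟨i, t, ht, h⟩ := isPlot_wedge_iff.1 hp x
    exact ⟨_, hf i n t ht, h.fun_comp f⟩

/-- A family of functions on `ℝ` with a common value at `0` glues to a function on the wedge. -/
def Wedge.desc {ι Y : Type*} (f : ι → ℝ → Y) (h : ∀ i j, f i 0 = f j 0) : Wedge ι → Y :=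
  Quotient.lift (s := wedgeSetoid ι) (fun a => f a.1 a.2) (by
    rintro ⟨i, a⟩ ⟨j, b⟩ (hab | ⟨ha, hb⟩)
    · rw [hab]
    · dsimp only at ha hb ⊢
      rw [ha, hb, h i j])

theorem Wedge.desc_mk {ι Y : Type*} (f : ι → ℝ → Y) (h : ∀ i j, f i 0 = f j 0) (a : Σ _ : ι, ℝ) :
    Wedge.desc f h (Wedge.mk a) = f a.1 a.2 :=
  rfl

/-! ### Diffeological vector spaces -/

namespace IsDiffeologicalVectorSpace

variable {V : Type*} [AddCommGroup V] [Module ℝ V] [DiffeologicalSpace V]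

theorem isPlot_add (hV : IsDiffeologicalVectorSpace V) {n : ℕ}
    {p q : EuclideanSpace ℝ (Fin n) → V} (hp : IsPlot p) (hq : IsPlot q) :
    IsPlot fun y => p y + q y :=
  hV.dSmooth_add n (fun y => (p y, q y)) ⟨hp, hq⟩

theorem isPlot_smul (hV : IsDiffeologicalVectorSpace V) {n : ℕ}
    {r : EuclideanSpace ℝ (Fin n) → ℝ} {p : EuclideanSpace ℝ (Fin n) → V}
    (hr : IsPlot r) (hp : IsPlot p) : IsPlot fun y => r y • p y :=
  hV.dSmooth_smul n (fun y => (r y, p y)) ⟨hr, hp⟩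

theorem isPlot_sum (hV : IsDiffeologicalVectorSpace V) {ι : Type*} (s : Finset ι) {n : ℕ}
    {p : ι → EuclideanSpace ℝ (Fin n) → V} (hp : ∀ i ∈ s, IsPlot (p i)) :
    IsPlot fun y => ∑ i ∈ s, p i y := by
  classical
  induction s using Finset.induction_on with
  | empty => simpa using isPlot_const
  | insert i s hi ih =>
    simp only [Finset.sum_insert hi]
    exact hV.isPlot_add (hp i (Finset.mem_insert_self i s))
      (ih fun j hj => hp j (Finset.mem_insert_of_mem hj))

end IsDiffeologicalVectorSpace

/-! ### Free diffeological vector spaces -/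

section Free

variable {X : Type*} [DiffeologicalSpace X]

theorem isPlot_freeDVS_iff {n : ℕ} {p : EuclideanSpace ℝ (Fin n) → FreeDVS X} :
    IsPlot p ↔ ∀ x, ∃ (k : ℕ) (r : Fin k → EuclideanSpace ℝ (Fin n) → ℝ)
      (c : Fin k → EuclideanSpace ℝ (Fin n) → X), (∀ i, IsPlot (r i)) ∧ (∀ i, IsPlot (c i)) ∧
      p =ᶠ[𝓝 x] fun y => ∑ i, Finsupp.single (c i y) (r i y) := by
  constructor
  · intro hp x
    by_cases hX : Nonempty X
    · obtain ⟨x₀⟩ := hX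
      have key := (isPlot_generateFrom_iff ?_ ?_).1 hp x
      · obtain ⟨q, ⟨k, -, z, hz, hq⟩, h⟩ := key
        exact ⟨k, fun i y => (z y i).1, fun i y => (z y i).2, fun i => (hz i).1,
          fun i => (hz i).2, h.trans (.of_eq hq)⟩
      · intro n v
        -- The extra term 0[x₀] keeps the number of terms positive when `v = 0`.
        refine ⟨v.support.card + 1, Nat.succ_pos _, fun _ =>
          Fin.cons (0, x₀) fun i => (v (v.support.equivFin.symm i), v.support.equivFin.symm i),
          isPlot_const, funext fun _ => ?_⟩
        simp only [rho, Function.comp, Fin.sum_univ_succ, Fin.cons_zero, Fin.cons_succ,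
          Finsupp.single_zero, zero_add]
        rw [Equiv.sum_comp v.support.equivFin.symm
          (fun a : v.support => Finsupp.single (a : X) (v a)),
          Finset.sum_coe_sort v.support fun a => Finsupp.single a (v a)]
        exact v.sum_single.symm
      · rintro n m p h ⟨k, hk, q, hq, hp⟩ hh
        exact ⟨k, hk, q ∘ h, isPlot_reparam hq hh, congrArg (· ∘ h) hp⟩
    · rw [not_nonempty_iff] at hX
      exact ⟨0, fun _ _ => 0, fun i => i.elim0, fun i => i.elim0, fun i => i.elim0,
        Filter.Eventually.of_forall fun y => Subsingleton.elim _ _⟩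
  · intro h
    refine isPlot_of_eventuallyEq fun x => ?_
    obtain ⟨k, r, c, hr, hc, h⟩ := h x
    refine ⟨_, ?_, h⟩
    rcases Nat.eq_zero_or_pos k with rfl | hk
    · simpa using isPlot_const
    · exact DiffeologicalSpace.isPlot_generatedFrom_of_mem
        ⟨k, hk, fun y i => (r i y, c i y), fun i => ⟨hr i, hc i⟩, rfl⟩

theorem isPlot_sum_single {κ : Type*} [Fintype κ] {n : ℕ}
    {r : κ → EuclideanSpace ℝ (Fin n) → ℝ} {c : κ → EuclideanSpace ℝ (Fin n) → X}
    (hr : ∀ i, IsPlot (r i)) (hc : ∀ i, IsPlot (c i)) :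
    IsPlot fun y => ∑ i, Finsupp.single (c i y) (r i y) := by
  refine isPlot_freeDVS_iff.2 fun x => ⟨Fintype.card κ, fun i => r ((Fintype.equivFin κ).symm i),
    fun i => c ((Fintype.equivFin κ).symm i), fun i => hr _, fun i => hc _, ?_⟩
  exact Filter.Eventually.of_forall fun y => (Equiv.sum_comp (Fintype.equivFin κ).symm
    fun i => Finsupp.single (c i y) (r i y)).symm

theorem isDiffeologicalVectorSpace_freeDVS : IsDiffeologicalVectorSpace (FreeDVS X) := by
  constructor
  · rintro n p ⟨hp₁, hp₂⟩
    refine isPlot_of_eventuallyEq fun x => ?_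
    obtain ⟨k, r, c, hr, hc, h⟩ := isPlot_freeDVS_iff.1 hp₁ x
    obtain ⟨k', r', c', hr', hc', h'⟩ := isPlot_freeDVS_iff.1 hp₂ x
    refine ⟨_, isPlot_sum_single (r := Sum.elim r r') (c := Sum.elim c c')
      (Sum.forall.2 ⟨hr, hr'⟩) (Sum.forall.2 ⟨hc, hc'⟩), ?_⟩
    filter_upwards [h, h'] with y hy hy'
    simp [hy, hy']
  · rintro n p ⟨hp₁, hp₂⟩
    refine isPlot_of_eventuallyEq fun x => ?_
    obtain ⟨k, r, c, hr, hc, h⟩ := isPlot_freeDVS_iff.1 hp₂ x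
    refine ⟨_, isPlot_sum_single (r := fun i y => (p y).1 * r i y)
      (fun i => (hp₁.contDiff.mul (hr i).contDiff).isPlot) hc, ?_⟩
    filter_upwards [h] with y hy
    simp [hy, Finset.smul_sum]

theorem FreeDVS.dSmooth_of : DSmooth (FreeDVS.of : X → FreeDVS X) := by
  intro n p hp
  have := isPlot_sum_single (κ := Unit) (r := fun _ _ => 1) (fun _ => isPlot_const) fun _ => hp
  simpa [FreeDVS.of, Function.comp_def] using this

variable {V : Type*} [AddCommGroup V] [Module ℝ V] [DiffeologicalSpace V]

theorem FreeDVS.dSmooth_linearCombination (hV : IsDiffeologicalVectorSpace V) {f : X → V}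
    (hf : DSmooth f) : DSmooth (Finsupp.linearCombination ℝ f) := by
  intro n p hp
  refine isPlot_of_eventuallyEq fun x => ?_
  obtain ⟨k, r, c, hr, hc, h⟩ := isPlot_freeDVS_iff.1 hp x
  refine ⟨_, hV.isPlot_sum Finset.univ fun i _ => hV.isPlot_smul (hr i) (hf n _ (hc i)), ?_⟩
  filter_upwards [h] with y hy
  simp [hy]

theorem FreeDVS.linearMap_ext {X V : Type*} [AddCommGroup V] [Module ℝ V]
    {g h : FreeDVS X →ₗ[ℝ] V}
    (H : ∀ x, g (FreeDVS.of x) = h (FreeDVS.of x)) : g = h :=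
  Finsupp.lhom_ext' fun x => LinearMap.ext_ring (H x)

theorem FreeDVS.linearCombination_of {X V : Type*} [AddCommGroup V] [Module ℝ V] (f : X → V) (x : X) :
    Finsupp.linearCombination ℝ f (FreeDVS.of x) = f x := by
  simp [FreeDVS.of]

theorem FreeDVS.isFreeOn {X : Type v} [DiffeologicalSpace X] :
    IsFreeOn.{u} (FreeDVS.of : X → FreeDVS X) := by
  refine ⟨isDiffeologicalVectorSpace_freeDVS, FreeDVS.dSmooth_of, fun V _ _ _ hV f hf => ?_⟩
  refine ⟨Finsupp.linearCombination ℝ f, ⟨FreeDVS.dSmooth_linearCombination hV hf,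
    FreeDVS.linearCombination_of f⟩, fun g hg => FreeDVS.linearMap_ext fun x => ?_⟩
  rw [hg.2, FreeDVS.linearCombination_of]

end Free

/-! ### Projectivity -/

section Lift

variable {V W : Type*} [AddCommGroup V] [Module ℝ V] [DiffeologicalSpace V]
  [AddCommGroup W] [Module ℝ W] [DiffeologicalSpace W]

open Manifold in
/-- Plots lift along linear subductions. -/
theorem IsSubduction.exists_isPlot_lift (hV : IsDiffeologicalVectorSpace V) {π : V →ₗ[ℝ] W}
    (hπ : IsSubduction π) {n : ℕ} {p : EuclideanSpace ℝ (Fin n) → W} (hp : IsPlot p) :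
    ∃ q : EuclideanSpace ℝ (Fin n) → V, IsPlot q ∧ ∀ x, π (q x) = p x := by
  have hloc : ∀ x, ∃ q : EuclideanSpace ℝ (Fin n) → V, IsPlot q ∧
      ∃ u : Set (EuclideanSpace ℝ (Fin n)), IsOpen u ∧ x ∈ u ∧ ∀ y ∈ u, π (q y) = p y := by
    intro x
    obtain ⟨q, hq, h⟩ := (isPlot_coinduced_iff hπ.1).1 (hπ.2 ▸ hp) x
    obtain ⟨u, hu, huo, hxu⟩ := eventually_nhds_iff.1 h
    exact ⟨q, hq, u, huo, hxu, fun y hy => (hu y hy).symm⟩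
  choose q hq u huo hxu hqu using hloc
  obtain ⟨ρ, hρ⟩ := SmoothPartitionOfUnity.exists_isSubordinate
    𝓘(ℝ, EuclideanSpace ℝ (Fin n)) isClosed_univ u huo fun x _ => Set.mem_iUnion.2 ⟨x, hxu x⟩
  -- Fibres of π are affine, so weighted averages of lifts with total weight 1 are again lifts.
  refine ⟨fun y => ∑ᶠ i, ρ i y • q i y, isPlot_of_eventuallyEq fun x => ?_, fun y => ?_⟩
  · obtain ⟨t, ht, hfin⟩ := ρ.locallyFinite x
    refine ⟨_, hV.isPlot_sum hfin.toFinset fun i _ =>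
      hV.isPlot_smul (ρ i).contMDiff.contDiff.isPlot (hq i), ?_⟩
    filter_upwards [ht] with y hy
    refine finsum_eq_sum_of_support_subset _ fun i hi => ?_
    rw [Set.Finite.coe_toFinset]
    exact ⟨y, fun h0 => hi (by simp only [h0, zero_smul]), hy⟩
  · dsimp only
    rw [← ρ.sum_finsupport_smul_eq_finsum y q, map_sum]
    have h : ∀ i ∈ ρ.finsupport y, π (ρ i y • q i y) = ρ i y • p y := by
      intro i hi
      rw [map_smul, hqu i y]
      exact hρ i (subset_tsupport _ (by simpa using hi))
    rw [Finset.sum_congr rfl h, ← Finset.sum_smul, ρ.sum_finsupport y (Set.mem_univ y), one_smul]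

/-- Smooth curves lift along linear subductions, with a prescribed value at `0`. -/
theorem IsSubduction.exists_dSmooth_lift (hV : IsDiffeologicalVectorSpace V) {π : V →ₗ[ℝ] W}
    (hπ : IsSubduction π) {c : ℝ → W} (hc : DSmooth c) {v : V} (hv : π v = c 0) :
    ∃ b : ℝ → V, DSmooth b ∧ b 0 = v ∧ ∀ t, π (b t) = c t := by
  have hcoord : ContDiff ℝ ∞ fun y : EuclideanSpace ℝ (Fin 1) => y 0 := by fun_prop
  have hline : ContDiff ℝ ∞ fun t : ℝ => t • EuclideanSpace.single (0 : Fin 1) (1 : ℝ) := by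
    fun_prop
  obtain ⟨q, hq, hqc⟩ := hπ.exists_isPlot_lift hV (hc 1 _ hcoord.isPlot)
  let b : ℝ → V := fun t => q (t • EuclideanSpace.single (0 : Fin 1) (1 : ℝ))
  have hπb : ∀ t, π (b t) = c t := fun t => by simp [b, hqc]
  -- The correction `v - b 0` lies in the kernel of π.
  refine ⟨fun t => b t + (v - b 0), fun n p hp => ?_, by simp, fun t => ?_⟩
  · exact hV.isPlot_add (isPlot_reparam hq (hline.comp hp.contDiff)) isPlot_const
  · rw [map_add, map_sub, hπb, hπb, hv, sub_self, add_zero]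

end Lift

/-- Lifts chosen branch by branch with the same value `v` at the origin glue to a smooth map on the
wedge, which extends linearly. -/
theorem isProjective_freeDVS_wedge {ι : Type w} [Nonempty ι] :
    IsProjective.{u, v} (FreeDVS (Wedge ι)) := by
  refine ⟨isDiffeologicalVectorSpace_freeDVS, fun V W _ _ _ _ _ _ hV _ π hπ g hg => ?_⟩
  have hbase : ∀ i j : ι, Wedge.mk ⟨i, 0⟩ = Wedge.mk ⟨j, 0⟩ :=
    fun i j => Wedge.mk_eq_mk.2 (Or.inr ⟨rfl, rfl⟩)
  let i₀ : ι := Classical.arbitrary ι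
  obtain ⟨v, hv⟩ := hπ.1 (g (FreeDVS.of (Wedge.mk ⟨i₀, 0⟩)))
  have hlift : ∀ i : ι, ∃ b : ℝ → V, DSmooth b ∧ b 0 = v ∧
      ∀ t, π (b t) = g (FreeDVS.of (Wedge.mk ⟨i, t⟩)) := fun i =>
    hπ.exists_dSmooth_lift hV (hg.comp (dSmooth_wedge_iff.1 FreeDVS.dSmooth_of i))
      (by rw [hv, hbase i₀ i]; rfl)
  choose b hb hb₀ hπb using hlift
  let f : Wedge ι → V := Wedge.desc b fun i j => (hb₀ i).trans (hb₀ j).symm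
  refine ⟨Finsupp.linearCombination ℝ f,
    FreeDVS.dSmooth_linearCombination hV (dSmooth_wedge_iff.2 hb),
    FreeDVS.linearMap_ext fun x => ?_⟩
  obtain ⟨⟨i, t⟩, rfl⟩ := Wedge.mk_surjective x
  rw [LinearMap.comp_apply, FreeDVS.linearCombination_of]
  exact hπb i t

/-! ### The D-topology of `F(X)` for a wedge `X` -/

theorem isClosed_dTopology_iff {X : Type*} [DiffeologicalSpace X] {A : Set X} :
    IsClosed[dTopology] A ↔
      ∀ (n : ℕ) (p : EuclideanSpace ℝ (Fin n) → X), IsPlot p → IsClosed (p ⁻¹' A) := by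
  rw [← @isOpen_compl_iff, isOpen_iff_preimages_plots]
  simp only [Set.preimage_compl, isOpen_compl_iff]

section Wedge

variable {ι : Type*}

theorem Wedge.eq_of_mk_eq_mk {i j : ι} {a b : ℝ} (h : Wedge.mk ⟨i, a⟩ = Wedge.mk ⟨j, b⟩)
    (ha : a ≠ 0) : i = j := by
  rcases Wedge.mk_eq_mk.1 h with h | h
  · exact congrArg Sigma.fst h
  · exact absurd h.1 ha

theorem Wedge.mk_injective (i : ι) : Function.Injective fun t : ℝ => Wedge.mk ⟨i, t⟩ := by
  intro a b h
  rcases Wedge.mk_eq_mk.1 h with h | h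
  · simpa using h
  · exact h.1.trans h.2.symm

/-- Smooth functions separate a point of a wedge from finitely many others. -/
theorem Wedge.exists_dSmooth_separating (s : Finset (Wedge ι)) (x : Wedge ι)
    (hx : ∀ i, x = Wedge.mk ⟨i, 0⟩ → s ⊆ {x}) :
    ∃ f : Wedge ι → ℝ, DSmooth f ∧ f x = 1 ∧ ∀ y ∈ s, y ≠ x → f y = 0 := by
  classical
  obtain ⟨⟨i, t⟩, rfl⟩ := Wedge.mk_surjective x
  rcases eq_or_ne t 0 with rfl | ht
  · refine ⟨fun _ => 1, dSmooth_const, rfl, fun y hy hyx => absurd (hx i rfl hy) ?_⟩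
    simpa using hyx
  have hfin : (((fun a : ℝ => Wedge.mk ⟨i, a⟩) ⁻¹' (s : Set (Wedge ι)) ∪ {0}) \ {t}).Finite :=
    ((s.finite_toSet.preimage (Wedge.mk_injective i).injOn).union (Set.finite_singleton 0)).sdiff
  -- A bump at `t` avoiding 0 and the other points of `s` on branch `i`; vanishing at 0, it extends
  -- by zero to the other branches.
  obtain ⟨φ, hφs, -, hφ, -, hφt⟩ := exists_contDiff_tsupport_subset (n := ⊤)
    (hfin.isClosed.isOpen_compl.mem_nhds (x := t) (by simp))
  have hφ0 : ∀ a, a ≠ t → (Wedge.mk ⟨i, a⟩ ∈ s ∨ a = 0) → φ a = 0 := by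
    intro a hat ha
    by_contra h
    exact hφs (subset_tsupport _ h) ⟨ha, hat⟩
  have h0 : φ 0 = 0 := hφ0 0 ht.symm (Or.inr rfl)
  refine ⟨Wedge.desc (fun j a => if j = i then φ a else 0) (by simp [h0]),
    dSmooth_wedge_iff.2 fun j => ?_, by simp [Wedge.desc_mk, hφt], fun y hy hyx => ?_⟩
  · by_cases hj : j = i
    · simpa [Wedge.desc_mk, hj] using hφ.dSmooth
    · simpa [Wedge.desc_mk, hj] using dSmooth_const
  · obtain ⟨⟨j, a⟩, rfl⟩ := Wedge.mk_surjective y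
    by_cases hj : j = i
    · subst hj
      rw [Wedge.desc_mk, if_pos rfl]
      exact hφ0 a (fun h => hyx (by rw [h])) (Or.inl hy)
    · simp [Wedge.desc_mk, hj]

/-- Smooth linear functionals separate the points of `F(X)`. -/
theorem FreeDVS.exists_dSmooth_linearCombination_ne_zero {v : FreeDVS (Wedge ι)} (hv : v ≠ 0) :
    ∃ f : Wedge ι → ℝ, DSmooth f ∧ Finsupp.linearCombination ℝ f v ≠ 0 := by
  classical
  -- Take a point other than the origin if the support has one; otherwise the support is the origin
  -- alone.
  obtain ⟨x, hx, hx'⟩ : ∃ x ∈ v.support, ∀ i, x = Wedge.mk ⟨i, 0⟩ → v.support ⊆ {x} := by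
    by_contra! H
    obtain ⟨x, hx⟩ := Finsupp.support_nonempty_iff.2 hv
    obtain ⟨i, rfl, hi⟩ := H x hx
    obtain ⟨y, hy, hyx⟩ := Finset.not_subset.1 hi
    obtain ⟨j, rfl, -⟩ := H y hy
    exact hyx (Finset.mem_singleton.2 (Wedge.mk_eq_mk.2 (Or.inr ⟨rfl, rfl⟩)))
  obtain ⟨f, hf, hfx, hf0⟩ := Wedge.exists_dSmooth_separating v.support x hx'
  refine ⟨f, hf, ?_⟩
  rw [Finsupp.linearCombination_apply, Finsupp.sum, Finset.sum_eq_single x]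
  · simpa [hfx] using hx
  · intro y hy hyx
    rw [hf0 y hy hyx, smul_zero]
  · exact fun h => absurd hx h

theorem isDiffeologicalVectorSpace_real : IsDiffeologicalVectorSpace ℝ where
  dSmooth_add _ _ hp := (hp.1.contDiff.add hp.2.contDiff).isPlot
  dSmooth_smul _ _ hp := (hp.1.contDiff.smul hp.2.contDiff).isPlot

theorem FreeDVS.isClosed_singleton (v : FreeDVS (Wedge ι)) : IsClosed[dTopology] {v} := by
  refine isClosed_dTopology_iff.2 fun n p hp => ?_
  rw [← isOpen_compl_iff, isOpen_iff_mem_nhds]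
  intro x hx
  obtain ⟨f, hf, hfv⟩ := FreeDVS.exists_dSmooth_linearCombination_ne_zero (sub_ne_zero.2 hx)
  rw [map_sub, sub_ne_zero] at hfv
  have hcont : Continuous fun y => Finsupp.linearCombination ℝ f (p y) :=
    (FreeDVS.dSmooth_linearCombination isDiffeologicalVectorSpace_real hf n p hp).contDiff.continuous
  filter_upwards [hcont.continuousAt.eventually_ne hfv] with y hy hyv
  exact hy (congrArg _ hyv)

/-- A subset of `F(X)` is closed in the D-topology if only finitely many of its elements are
supported in any given finite set of branches of the wedge `X`. -/
theorem FreeDVS.isClosed_of_finite_branches {A : Set (FreeDVS (Wedge ι))}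
    (hA : ∀ S : Finset ι,
      {v ∈ A | ∀ x ∈ v.support, ∃ i ∈ S, ∃ t, x = Wedge.mk ⟨i, t⟩}.Finite) :
    IsClosed[dTopology] A := by
  classical
  refine isClosed_dTopology_iff.2 fun n p hp => ?_
  rw [← isOpen_compl_iff, isOpen_iff_mem_nhds]
  intro x hx
  obtain ⟨k, r, c, -, hc, hpx⟩ := isPlot_freeDVS_iff.1 hp x
  choose i t _ hit using fun l => isPlot_wedge_iff.1 (hc l) x
  have hfin := hA (Finset.univ.image i)
  -- Near `x` the plot stays in the branches `i l`, so it can meet `A` only in the finite, hence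
  -- closed, set `B`.
  set B := {v ∈ A | ∀ x ∈ v.support, ∃ j ∈ Finset.univ.image i, ∃ t, x = Wedge.mk ⟨j, t⟩}
  have hB : IsClosed (p ⁻¹' B) := by
    rw [← Set.biUnion_preimage_singleton]
    exact hfin.isClosed_biUnion fun v _ =>
      isClosed_dTopology_iff.1 (FreeDVS.isClosed_singleton v) n p hp
  filter_upwards [hB.isOpen_compl.mem_nhds (x := x) fun h => hx h.1, hpx,
    Filter.eventually_all.2 hit] with y hyB hpy hy hyA
  refine hyB ⟨hyA, fun z hz => ?_⟩
  rw [hpy] at hz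
  obtain ⟨l, -, hl⟩ := Finset.mem_biUnion.1 (Finsupp.support_finsetSum hz)
  obtain rfl := Finset.mem_singleton.1 (Finsupp.support_single_subset hl)
  exact ⟨i l, Finset.mem_image_of_mem _ (Finset.mem_univ _), t l y, hy l⟩

end Wedge

/-! ### Addition is not continuous -/

/-- The element `[x] + [y]`, where `x` is the point `1 / sⱼ` of the branch `s` and `y` is the point
`1 / sⱼ` of the branch of the constant sequence `j`. -/
def pairSum (s : ℕ+ → ℕ+) (j : ℕ+) : FreeDVS SeqWedge :=
  FreeDVS.of (Wedge.mk ⟨s, ((s j : ℕ) : ℝ)⁻¹⟩) +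
    FreeDVS.of (Wedge.mk ⟨fun _ => j, ((s j : ℕ) : ℝ)⁻¹⟩)

/-- Both coefficients are positive, so nothing cancels even if `x = y`. -/
theorem FreeDVS.of_add_of_support {X : Type*} (x y : X) :
    x ∈ (FreeDVS.of x + FreeDVS.of y).support ∧ y ∈ (FreeDVS.of x + FreeDVS.of y).support := by
  classical
  constructor <;> simp only [FreeDVS.of, Finsupp.mem_support_iff, Finsupp.add_apply,
    Finsupp.single_apply] <;> split_ifs <;> norm_num

theorem isClosed_range_pairSum :
    IsClosed[dTopology] {v : FreeDVS SeqWedge | ∃ s j, v = pairSum s j} := by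
  refine FreeDVS.isClosed_of_finite_branches fun S => ?_
  have hinj : Function.Injective fun (j : ℕ+) (_ : ℕ+) => j := fun a b h => congrFun h 1
  refine ((S.finite_toSet.prod (S.finite_toSet.preimage hinj.injOn)).image
    fun a : (ℕ+ → ℕ+) × ℕ+ => pairSum a.1 a.2).subset ?_
  rintro _ ⟨⟨s, j, rfl⟩, h⟩
  have hpos : ((s j : ℕ) : ℝ)⁻¹ ≠ 0 := by simp
  -- A point other than the origin determines its branch, so `S` contains both `s` and the constant
  -- sequence `j`, leaving finitely many pairs.
  have hmem : ∀ i, Wedge.mk ⟨i, ((s j : ℕ) : ℝ)⁻¹⟩ ∈ (pairSum s j).support → i ∈ S := by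
    intro i hi
    obtain ⟨k, hk, t, ht⟩ := h _ hi
    rwa [Wedge.eq_of_mk_eq_mk ht hpos]
  exact ⟨(s, j), ⟨hmem _ (FreeDVS.of_add_of_support _ _).1,
    hmem _ (FreeDVS.of_add_of_support _ _).2⟩, rfl⟩

theorem not_isClosed_preimage_range_pairSum :
    ¬ IsClosed[@instTopologicalSpaceProd _ _ dTopology dTopology]
      ((fun z : FreeDVS SeqWedge × FreeDVS SeqWedge => z.1 + z.2) ⁻¹'
        {v : FreeDVS SeqWedge | ∃ s j, v = pairSum s j}) := by
  let _ : TopologicalSpace (FreeDVS SeqWedge) := dTopology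
  intro hcl
  let o : SeqWedge := Wedge.mk ⟨fun _ => 1, 0⟩
  have ho : ∀ i, (Wedge.mk ⟨i, 0⟩ : SeqWedge) = o :=
    fun i => Wedge.mk_eq_mk.2 (Or.inr ⟨rfl, rfl⟩)
  -- The sum 2[o] is supported at the origin, whereas every `pairSum s j` has a support point away
  -- from it.
  have hnot : (FreeDVS.of o, FreeDVS.of o) ∈
      ((fun z : FreeDVS SeqWedge × FreeDVS SeqWedge => z.1 + z.2) ⁻¹'
        {v : FreeDVS SeqWedge | ∃ s j, v = pairSum s j})ᶜ := by
    rintro ⟨s, j, h⟩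
    have hs := (FreeDVS.of_add_of_support (Wedge.mk ⟨s, ((s j : ℕ) : ℝ)⁻¹⟩ : SeqWedge)
      (Wedge.mk ⟨fun _ => j, ((s j : ℕ) : ℝ)⁻¹⟩)).1
    change _ ∈ (pairSum s j).support at hs
    rw [← h] at hs
    have hso : (Wedge.mk ⟨s, ((s j : ℕ) : ℝ)⁻¹⟩ : SeqWedge) = o := by
      by_contra hne
      simp [FreeDVS.of, Ne.symm hne] at hs
    have := Wedge.mk_injective s (hso.trans (ho s).symm)
    simp at this
  obtain ⟨U, W, hU, hW, hoU, hoW, hUW⟩ := isOpen_prod_iff.1 hcl.isOpen_compl _ _ hnot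
  have hnhds : ∀ (O : Set (FreeDVS SeqWedge)), IsOpen O → FreeDVS.of o ∈ O → ∀ i : ℕ+ → ℕ+,
      ∃ N : ℕ+, ∀ m : ℕ+, N ≤ m → FreeDVS.of (Wedge.mk ⟨i, ((m : ℕ) : ℝ)⁻¹⟩) ∈ O := by
    intro O hO hoO i
    have hcont : Continuous fun t : ℝ => FreeDVS.of (Wedge.mk ⟨i, t⟩ : SeqWedge) :=
      (dSmooth_wedge_iff.1 FreeDVS.dSmooth_of i).continuous
    have h0 : (fun t : ℝ => FreeDVS.of (Wedge.mk ⟨i, t⟩ : SeqWedge)) ⁻¹' O ∈ 𝓝 (0 : ℝ) :=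
      (hO.preimage hcont).mem_nhds (by simpa [ho i] using hoO)
    obtain ⟨N, hN⟩ := Filter.eventually_atTop.1
      ((tendsto_inv_atTop_nhds_zero_nat (𝕜 := ℝ)).eventually h0)
    exact ⟨N.succPNat, fun m hm => hN m (by
      have : (N.succPNat : ℕ) ≤ m := hm
      rw [Nat.succPNat_coe] at this
      omega)⟩
  choose M hM using fun j : ℕ+ => hnhds W hW hoW fun _ => j
  -- The bound `s N ≥ N` puts the point on branch `s` in `U`; `s N ≥ M N` puts the point on the
  -- constant branch `N` in `W`.
  let s : ℕ+ → ℕ+ := fun j => max j (M j)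
  obtain ⟨N, hN⟩ := hnhds U hU hoU s
  exact hUW (Set.mk_mem_prod (hN (s N) (le_max_left _ _)) (hM N (s N) (le_max_right _ _)))
    ⟨s, N, rfl⟩

end DVS

end

theorem mainTheorem4 :
    DVS.IsFreeOn.{u} (DVS.FreeDVS.of : DVS.SeqWedge → DVS.FreeDVS DVS.SeqWedge) ∧
    DVS.IsProjective.{u, v} (DVS.FreeDVS DVS.SeqWedge) ∧
    ¬ DVS.IsTopologicalVectorSpaceD (DVS.FreeDVS DVS.SeqWedge) ∧
    ¬ Continuous[@instTopologicalSpaceProd _ _ dTopology dTopology, dTopology]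
        (fun z : DVS.FreeDVS DVS.SeqWedge × DVS.FreeDVS DVS.SeqWedge => z.1 + z.2) ∧
    ∃ A : Set (DVS.FreeDVS DVS.SeqWedge), IsClosed[dTopology] A ∧
      ¬ IsClosed[@instTopologicalSpaceProd _ _ dTopology dTopology]
        ((fun z : DVS.FreeDVS DVS.SeqWedge × DVS.FreeDVS DVS.SeqWedge => z.1 + z.2) ⁻¹' A) := by
  have hadd : ¬ Continuous[@instTopologicalSpaceProd _ _ dTopology dTopology, dTopology]
      (fun z : DVS.FreeDVS DVS.SeqWedge × DVS.FreeDVS DVS.SeqWedge => z.1 + z.2) := by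
    let _ : TopologicalSpace (DVS.FreeDVS DVS.SeqWedge) := dTopology
    exact fun h => DVS.not_isClosed_preimage_range_pairSum (DVS.isClosed_range_pairSum.preimage h)
  exact ⟨DVS.FreeDVS.isFreeOn, DVS.isProjective_freeDVS_wedge, fun h => hadd h.1, hadd,
    _, DVS.isClosed_range_pairSum, DVS.not_isClosed_preimage_range_pairSum⟩
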